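/- Let $D$ be a noncommutative division ring of characteristic $2$ and let $n$ be a positive integer. If $D$ contains at least four elements, then every matrix in $\mathrm{M}_n(D)$ is expressible as a product of four diagonalizable matrices in $\mathrm{M}_n(D)$. Here a matrix $B\in\mathrm{M}_n(D)$ is called diagonalizable if there are an invertible matrix $P\in\mathrm{M}_n(D)$ and elements $d_1,\dots,d_n\in D$ such that $B=P\,\mathrm{diag}(d_1,\dots,d_n)\,P^{-1}$. -/

import Mathlib

/-- A square matrix over a (not necessarily commutative) ring is diagonalizable if it is similar,
over that ring, to a diagonal matrix. -/
def Matrix.IsDiagonalizable {n R : Type*} [Fintype n] [DecidableEq n] [Ring R]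
    (A : Matrix n n R) : Prop :=
  ∃ (P : (Matrix n n R)ˣ) (d : n → R),
    A = (P : Matrix n n R) * Matrix.diagonal d * ((P⁻¹ : (Matrix n n R)ˣ) : Matrix n n R)

/-! Two diagonalizable factors suffice; the other two are identities. If all double centralizers
were finite, a Wedderburn-type argument would produce a finite noncommutative division ring; so `D`
contains an infinite commutative field `K` (`Subfield.exists_infinite_doubleCentralizer`). Splitting
off cyclic summands of maximal length (`exists_cyclic_isCompl`) reduces to a map `f` shifting a
basis `e_0, …, e_k`. There `f = g ∘ h`, where `g` is the companion map of a polynomial with distinct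
nonzero roots in `K`, and `h` fixes every `e_j` but the last, where it corrects `g` to `f`
(`exists_eq_comp_of_cyclic`). The eigenvectors of each factor span the space. -/

open Polynomial in
/-- A vector killed by a product of distinct linear factors in `T` is a sum of eigenvectors. -/
theorem Module.End.exists_eq_sum_eigenvectors {K V : Type*} [Field K] [AddCommGroup V] [Module K V]
    (T : Module.End K V) (s : Finset K) (v : V)
    (h : aeval T (∏ c ∈ s, (X - C c)) v = 0) :
    ∃ z : K → V, (∀ c ∈ s, T (z c) = c • z c) ∧ v = ∑ c ∈ s, z c := by
  classical
  rcases s.eq_empty_or_nonempty with rfl | hs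
  · exact ⟨0, by simp, by simpa using h⟩
  -- The Lagrange basis polynomials sum to `1`, and `X - c` times the one at `c` is a scalar
  -- multiple of the full product.
  refine ⟨fun c => aeval T (Lagrange.basis s id c) v, fun c hc => ?_, ?_⟩
  · have key : (X - C c) * Lagrange.basis s id c
        = C (Lagrange.nodalWeight s id c) * ∏ c ∈ s, (X - C c) := by
      have := Lagrange.nodal_eq_mul_nodal_erase (v := id) hc
      rw [Lagrange.basis_eq_prod_sub_inv_mul_nodal_div hc, ← Lagrange.nodal_erase_eq_nodal_div hc]
      rw [Lagrange.nodal_eq s] at this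
      simp only [id] at this
      rw [this]
      ring
    have h2 := congrArg (fun p => aeval T p v) key
    simp only [map_mul, Module.End.mul_apply, h, map_zero] at h2
    simpa [sub_eq_zero] using h2
  · have := congrArg (fun p => aeval T p v) (Lagrange.sum_basis (s := s) (v := id) (by simp) hs)
    simpa [map_sum, LinearMap.sum_apply] using this.symm

/-! ### Double centralizers and an infinite commutative subfield -/

/-- The double centralizer of an element of a division ring. -/
def Subfield.doubleCentralizer {D : Type*} [DivisionRing D] (a : D) : Subfield D where
  __ := Subring.centralizer (Set.centralizer ({a} : Set D))
  inv_mem' _ hx := Set.inv_mem_centralizer₀ hx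

namespace Subfield

variable {D : Type*} [DivisionRing D]

theorem mem_doubleCentralizer {a x : D} :
    x ∈ doubleCentralizer a ↔ ∀ y, a * y = y * a → y * x = x * y := by
  change x ∈ Set.centralizer (Set.centralizer ({a} : Set D)) ↔ _
  simp [Set.mem_centralizer_iff]

theorem self_mem_doubleCentralizer (a : D) : a ∈ doubleCentralizer a :=
  mem_doubleCentralizer.2 fun _ h => h.symm

theorem mul_comm_of_mem_doubleCentralizer {a x y : D} (hx : x ∈ doubleCentralizer a)
    (hy : y ∈ doubleCentralizer a) : x * y = y * x :=
  mem_doubleCentralizer.1 hy x (mem_doubleCentralizer.1 hx a rfl)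

theorem doubleCentralizer_le {a b : D} (hb : b ∈ doubleCentralizer a) :
    doubleCentralizer b ≤ doubleCentralizer a := fun _ hx =>
  mem_doubleCentralizer.2 fun y hy =>
    mem_doubleCentralizer.1 hx y (mem_doubleCentralizer.1 hb y hy).symm

instance (a : D) : Field (doubleCentralizer a) where
  __ := (inferInstance : DivisionRing (doubleCentralizer a))
  mul_comm x y := Subtype.ext (mul_comm_of_mem_doubleCentralizer x.2 y.2)

theorem conj_mem_doubleCentralizer {a x k : D} (hx : x ≠ 0) (hk : k ∈ doubleCentralizer a) :
    x * k * x⁻¹ ∈ doubleCentralizer (x * a * x⁻¹) := by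
  rw [mem_doubleCentralizer] at hk ⊢
  intro y hy
  have h := hk (x⁻¹ * y * x) (by
    have := congrArg (fun z => x⁻¹ * z * x) hy
    simpa [mul_assoc, hx] using this)
  have := congrArg (fun z => x * z * x⁻¹) h
  simpa [mul_assoc, hx] using this

open Polynomial in
/-- A noncentral element with finite double centralizer is conjugate to another element of it. -/
theorem exists_conj_mem_doubleCentralizer {a b : D} (hab : a * b ≠ b * a)
    [Finite (doubleCentralizer a)] :
    ∃ x : D, x ≠ 0 ∧ x * a * x⁻¹ ∈ doubleCentralizer a ∧ x * a ≠ a * x := by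
  classical
  have := Fintype.ofFinite (doubleCentralizer a)
  let K := doubleCentralizer a
  -- Right multiplication by `a` is linear for the left `K`-structure, and `T ^ q = T` for `q = |K|`
  -- because `a ∈ K`. A nonzero eigenvector `z` with eigenvalue `c` conjugates `a` to `c ∈ K`; as
  -- `b` is a sum of eigenvectors, one of them fails to commute with `a`.
  let T : Module.End K D :=
    { toFun := fun x => x * a
      map_add' := fun x y => add_mul x y a
      map_smul' := fun c x => by simp [Subfield.smul_def, mul_assoc] }
  have hpow : ∀ (n : ℕ) (x : D), (T ^ n) x = x * a ^ n := by
    intro n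
    induction n with
    | zero => simp
    | succ n ih =>
      intro x
      rw [pow_succ, Module.End.mul_apply, ih, pow_succ', ← mul_assoc]
      rfl
  have haq : a ^ Fintype.card K = a :=
    congrArg Subtype.val (FiniteField.pow_card (⟨a, self_mem_doubleCentralizer a⟩ : K))
  have hprod : (∏ c : K, (X - C c)) = X ^ Fintype.card K - X := by
    have h1 : 1 < Fintype.card K := Fintype.one_lt_card
    have hr := FiniteField.roots_X_pow_card_sub_X K
    have := prod_multiset_X_sub_C_of_monic_of_roots_card_eq
      (p := (X ^ Fintype.card K - X : K[X]))
      (monic_X_pow_sub (by rw [degree_X]; exact_mod_cast h1))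
      (by rw [hr, FiniteField.X_pow_card_sub_X_natDegree_eq K h1]; rfl)
    rw [hr] at this
    exact this
  obtain ⟨z, hz, hbz⟩ := T.exists_eq_sum_eigenvectors Finset.univ b (by
    rw [hprod]
    simp only [map_sub, map_pow, aeval_X, LinearMap.sub_apply, hpow, haq]
    exact sub_self _)
  by_contra! hcon
  refine hab ?_
  have hcomm : ∀ c, z c * a = a * z c := by
    intro c
    by_cases h0 : z c = 0
    · simp [h0]
    refine hcon _ h0 ?_
    have : z c * a = c * z c := hz c (Finset.mem_univ _)
    rw [this, mul_inv_cancel_right₀ h0]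
    exact c.2
  rw [hbz, Finset.sum_mul, Finset.mul_sum]
  exact Finset.sum_congr rfl fun c _ => (hcomm c).symm

/-- A noncommutative division ring contains an infinite commutative subfield. -/
theorem exists_infinite_doubleCentralizer (hnc : ∃ x y : D, x * y ≠ y * x) :
    ∃ a : D, Infinite (doubleCentralizer a) := by
  classical
  by_contra! hfin
  obtain ⟨a, b, hab⟩ := hnc
  have hf : ∀ c : D, Finite (doubleCentralizer c) := fun c => by simpa using hfin c
  obtain ⟨x, hx0, hxa, hne⟩ := exists_conj_mem_doubleCentralizer hab
  set K := doubleCentralizer a with hK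
  have hconj : ∀ k ∈ K, x * k * x⁻¹ ∈ K := fun k hk =>
    doubleCentralizer_le hxa (conj_mem_doubleCentralizer hx0 hk)
  have hconj' : ∀ (n : ℕ), ∀ k ∈ K, ∃ k' ∈ K, x ^ n * k = k' * x ^ n := by
    intro n
    induction n with
    | zero => exact fun k hk => ⟨k, hk, by simp⟩
    | succ n ih =>
      intro k hk
      obtain ⟨k', hk', h⟩ := ih _ (hconj k hk)
      refine ⟨k', hk', ?_⟩
      rw [pow_succ, ← mul_assoc, ← h]
      simp [mul_assoc, hx0]
  -- Conjugation by `x` carries `K` into itself, so `M` is stable under right multiplication by `K`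
  -- and `x`. It is finite and contains `1`, hence contains the ring generated by `a` and `x`, which
  -- Wedderburn's theorem makes commutative.
  let M : Submodule K D := Submodule.span K (Set.range fun n : ℕ => x ^ n)
  have hrange : (Set.range fun n : ℕ => x ^ n).Finite := by
    refine Set.Finite.subset (s := (doubleCentralizer x : Set D)) (Set.toFinite _) ?_
    rintro _ ⟨n, rfl⟩
    exact pow_mem (self_mem_doubleCentralizer x) n
  have hMfin : Finite M := by
    have : Module.Finite K M := Module.Finite.span_of_finite K hrange
    exact Module.finite_of_finite K
  have hmulx : ∀ m ∈ M, m * x ∈ M := by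
    intro m hm
    induction hm using Submodule.span_induction with
    | mem m hm =>
      obtain ⟨n, rfl⟩ := hm
      exact Submodule.subset_span ⟨n + 1, pow_succ x n⟩
    | zero => simp
    | add m m' _ _ h h' => rw [add_mul]; exact M.add_mem h h'
    | smul c m _ h =>
      have := M.smul_mem c h
      rwa [Subfield.smul_def, smul_eq_mul, ← mul_assoc] at this
  have hmulK : ∀ k ∈ K, ∀ m ∈ M, m * k ∈ M := by
    intro k hk m hm
    induction hm using Submodule.span_induction with
    | mem m hm =>
      obtain ⟨n, rfl⟩ := hm
      obtain ⟨k', hk', h⟩ := hconj' n k hk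
      simp only [h]
      exact M.smul_mem ⟨k', hk'⟩ (Submodule.subset_span ⟨n, rfl⟩)
    | zero => simp
    | add m m' _ _ h h' => rw [add_mul]; exact M.add_mem h h'
    | smul c m _ h =>
      have := M.smul_mem c h
      rwa [Subfield.smul_def, smul_eq_mul, ← mul_assoc] at this
  let R : Subring D := Subring.closure {a, x}
  have hR : ∀ r ∈ R, ∀ m ∈ M, m * r ∈ M := by
    intro r hr
    induction hr using Subring.closure_induction with
    | mem r hr =>
      rcases hr with rfl | rfl
      · exact hmulK _ (self_mem_doubleCentralizer _)
      · exact hmulx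
    | zero => simp
    | one => simp
    | add r s _ _ h h' => exact fun m hm => by rw [mul_add]; exact M.add_mem (h m hm) (h' m hm)
    | neg r _ h => exact fun m hm => by rw [mul_neg]; exact M.neg_mem (h m hm)
    | mul r s _ _ h h' => exact fun m hm => by rw [← mul_assoc]; exact h' _ (h m hm)
  have hRfin : Finite R := by
    refine Set.Finite.subset (s := (M : Set D)) (Set.toFinite _) fun r hr => ?_
    simpa using hR r hr 1 (Submodule.subset_span ⟨0, pow_zero x⟩)
  have hcomm := (Finite.isDomain_to_isField R).mul_comm
    ⟨x, Subring.subset_closure (by simp)⟩ ⟨a, Subring.subset_closure (by simp)⟩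
  exact hne (congrArg Subtype.val hcomm)

end Subfield

namespace Module.End

/-! ### Factoring a cyclic endomorphism -/

section Eigenvectors

variable {D V : Type*} [DivisionRing D] [AddCommGroup V] [Module D V]

/-- An endomorphism whose eigenvectors span the whole space. -/
def IsSpannedByEigenvectors (f : Module.End D V) : Prop :=
  Submodule.span D {x | ∃ a : D, f x = a • x} = ⊤

theorem apply_mem_span_eigenvectors (f : Module.End D V) {x : V}
    (hx : x ∈ Submodule.span D {x | ∃ a : D, f x = a • x}) :
    f x ∈ Submodule.span D {x | ∃ a : D, f x = a • x} := by
  induction hx using Submodule.span_induction with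
  | mem x hx =>
    obtain ⟨a, ha⟩ := hx
    rw [ha]
    exact Submodule.smul_mem _ _ (Submodule.subset_span ⟨a, ha⟩)
  | zero => simp
  | add x y _ _ hx hy => rw [map_add]; exact Submodule.add_mem _ hx hy
  | smul c x _ hx => rw [map_smul]; exact Submodule.smul_mem _ _ hx

/-- A companion endomorphism, whose polynomial is a product of distinct linear factors over a
commutative field mapping to `D`, is spanned by eigenvectors. -/
theorem isSpannedByEigenvectors_of_companion {K : Type*} [Field K] (i : K →+* D) {k : ℕ}
    (e : Module.Basis (Fin (k + 1)) D V) (s : Finset K) (hs : s.card = k + 1)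
    (g : Module.End D V) (hg : ∀ j : Fin k, g (e j.castSucc) = e j.succ)
    (hlast : g (e (Fin.last k)) =
      -∑ j : Fin (k + 1), i ((∏ c ∈ s, (Polynomial.X - Polynomial.C c)).coeff j) • e j) :
    g.IsSpannedByEigenvectors := by
  let _ : Module K V := Module.compHom V i
  have hsmul : ∀ (c : K) (x : V), c • x = i c • x := fun _ _ => rfl
  -- Over `K` polynomials can be evaluated at `g`; the last column says that `p(T)` kills `e 0`.
  let T : Module.End K V :=
    { toFun := g
      map_add' := g.map_add
      map_smul' := fun c x => by simp [hsmul] }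
  set p := ∏ c ∈ s, (Polynomial.X - Polynomial.C c) with hp
  have hdeg : p.natDegree = k + 1 := by
    rw [hp, Polynomial.natDegree_finsetProd_X_sub_C_eq_card, hs]
  have hmonic : p.Monic := Polynomial.monic_prod_of_monic _ _ fun c _ => Polynomial.monic_X_sub_C c
  have hlead : p.coeff (k + 1) = 1 := hdeg ▸ hmonic.coeff_natDegree
  have hT : ∀ x, T x = g x := fun _ => rfl
  have hpow : ∀ (j : ℕ) (hj : j < k + 1), (T ^ j) (e 0) = e ⟨j, hj⟩ := by
    intro j
    induction j with
    | zero => intro hj; simp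
    | succ j ih =>
      intro hj
      rw [pow_succ', Module.End.mul_apply, ih (by omega), hT]
      exact hg ⟨j, by omega⟩
  have hzero : Polynomial.aeval T p (e 0) = 0 := by
    rw [Polynomial.aeval_eq_sum_range, hdeg, Finset.sum_range_succ, LinearMap.add_apply,
      hlead, one_smul, pow_succ', Module.End.mul_apply, hpow k (by omega), hT]
    change _ + g (e (Fin.last k)) = 0
    rw [hlast, add_neg_eq_zero, LinearMap.sum_apply,
      Finset.sum_range (fun j => (p.coeff j • T ^ j) (e 0))]
    refine Finset.sum_congr rfl fun j _ => ?_
    rw [LinearMap.smul_apply, hpow j j.2, hsmul]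
  obtain ⟨z, hz, hsum⟩ := T.exists_eq_sum_eigenvectors s (e 0) hzero
  have h0 : e 0 ∈ Submodule.span D {x | ∃ a : D, g x = a • x} := by
    rw [hsum]
    exact Submodule.sum_mem _ fun c hc => Submodule.subset_span ⟨i c, hz c hc⟩
  rw [IsSpannedByEigenvectors, eq_top_iff, ← e.span_eq, Submodule.span_le]
  rintro _ ⟨j, rfl⟩
  induction j using Fin.induction with
  | zero => exact h0
  | succ j ih => rw [← hg]; exact g.apply_mem_span_eigenvectors ih

/-- An endomorphism that fixes all but the last basis vector, whose last diagonal
coefficient is not `1`, is spanned by eigenvectors. -/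
theorem isSpannedByEigenvectors_of_fixes {k : ℕ} (e : Module.Basis (Fin (k + 1)) D V)
    (h : Module.End D V) (hfix : ∀ j : Fin k, h (e j.castSucc) = e j.castSucc) {δ : D} (hδ : δ ≠ 1)
    {y : V} (hy : h y = y) (hlast : h (e (Fin.last k)) = δ • e (Fin.last k) + y) :
    h.IsSpannedByEigenvectors := by
  have hδ' : δ - 1 ≠ 0 := sub_ne_zero.2 hδ
  rw [IsSpannedByEigenvectors, eq_top_iff, ← e.span_eq, Submodule.span_le]
  rintro _ ⟨j, rfl⟩
  induction j using Fin.lastCases with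
  | cast j => exact Submodule.subset_span ⟨1, by rw [hfix, one_smul]⟩
  | last =>
    have hymem : y ∈ Submodule.span D {x | ∃ a : D, h x = a • x} :=
      Submodule.subset_span ⟨1, by rw [hy, one_smul]⟩
    have hz : e (Fin.last k) + (δ - 1)⁻¹ • y ∈ Submodule.span D {x | ∃ a : D, h x = a • x} := by
      refine Submodule.subset_span ⟨δ, ?_⟩
      have hinv : (1 : D) + (δ - 1)⁻¹ = δ * (δ - 1)⁻¹ := by
        have := mul_inv_cancel₀ hδ'
        rw [sub_mul, one_mul] at this
        rw [sub_eq_iff_eq_add.1 this]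
      rw [map_add, map_smul, hy, hlast, smul_add, smul_smul, ← hinv, add_smul, one_smul, add_assoc]
    have := Submodule.sub_mem _ hz (Submodule.smul_mem _ (δ - 1)⁻¹ hymem)
    rwa [add_sub_cancel_right] at this

/-- Once `k` nonzero roots are fixed, at most one choice of the last root gives the forbidden
product. -/
theorem exists_finset_prod_ne {K : Type*} [Field K] [Infinite K] (i : K →+* D) (k : ℕ) (w : D) :
    ∃ s : Finset K, s.card = k + 1 ∧ 0 ∉ s ∧ i (∏ c ∈ s, -c) ≠ w := by
  classical
  obtain ⟨t, ht, htc⟩ := (Set.finite_singleton (0 : K)).infinite_compl.exists_subset_card_eq k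
  have ht0 : (0 : K) ∉ t := fun h => ht h rfl
  have hprod : ∏ c ∈ t, -c ≠ 0 :=
    Finset.prod_ne_zero_iff.2 fun c hc => neg_ne_zero.2 fun h => ht0 (h ▸ hc)
  have hfin : {c : K | i (-c * ∏ c ∈ t, -c) = w}.Finite :=
    Set.Subsingleton.finite fun c hc d hd => by
      have := i.injective ((hc : _ = w).trans (hd : _ = w).symm)
      exact neg_injective (mul_right_cancel₀ hprod this)
  obtain ⟨c, hc⟩ := (hfin.union (insert 0 t).finite_toSet).infinite_compl.nonempty
  simp only [Set.mem_compl_iff, Set.mem_union, Set.mem_ofPred_eq, Finset.coe_insert,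
    Set.mem_insert_iff, Finset.mem_coe, not_or] at hc
  refine ⟨insert c t, by rw [Finset.card_insert_of_notMem hc.2.2, htc], ?_, ?_⟩
  · simp only [Finset.mem_insert, not_or]
    exact ⟨fun h => hc.2.1 h.symm, ht0⟩
  · rw [Finset.prod_insert hc.2.2]
    exact hc.1

/-- A cyclic endomorphism is a product of two endomorphisms spanned by eigenvectors. -/
theorem exists_eq_comp_of_cyclic {K : Type*} [Field K] [Infinite K] (i : K →+* D) {k : ℕ}
    (e : Module.Basis (Fin (k + 1)) D V) (f : Module.End D V)
    (hf : ∀ j : Fin k, f (e j.castSucc) = e j.succ) :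
    ∃ g h : Module.End D V,
      g.IsSpannedByEigenvectors ∧ h.IsSpannedByEigenvectors ∧ f = g ∘ₗ h := by
  set w := e.repr (f (e (Fin.last k))) 0 with hw
  obtain ⟨s, hs, hs0, hsw⟩ := exists_finset_prod_ne i k (-w)
  set p := ∏ c ∈ s, (Polynomial.X - Polynomial.C c) with hp
  have hp0 : p.coeff 0 = ∏ c ∈ s, -c := by
    rw [Polynomial.coeff_zero_eq_eval_zero, hp, Polynomial.eval_prod]
    simp
  have hp0' : i (p.coeff 0) ≠ 0 := by
    rw [hp0, map_ne_zero]
    exact Finset.prod_ne_zero_iff.2 fun c hc => neg_ne_zero.2 fun h => hs0 (h ▸ hc)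
  let g : Module.End D V := e.constr ℕ
    (Fin.lastCases (-∑ j : Fin (k + 1), i (p.coeff j) • e j) (fun j => e j.succ))
  have hg : ∀ j : Fin k, g (e j.castSucc) = e j.succ := fun j => by
    simp [g]
  have hglast : g (e (Fin.last k)) = -∑ j : Fin (k + 1), i (p.coeff j) • e j := by
    simp [g]
  -- This `δ` cancels the `e 0` component of `r`, so `r = g y` with `y` in the span of the vectors
  -- fixed by `h`. The choice of `s` excludes `δ = 1`, which would mean `p(0) = -w`.
  set δ := -(w * (i (p.coeff 0))⁻¹) with hδ
  set r := f (e (Fin.last k)) - δ • g (e (Fin.last k)) with hr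
  have hr0 : e.repr r 0 = 0 := by
    have : e.repr (g (e (Fin.last k))) 0 = -i (p.coeff 0) := by
      rw [hglast, map_neg, Finsupp.neg_apply, e.repr_sum_self]
      simp
    rw [hr, map_sub, map_smul, Finsupp.sub_apply, Finsupp.smul_apply, this, ← hw, hδ]
    simp [hp0']
  set y := ∑ j : Fin k, e.repr r j.succ • e j.castSucc with hy
  have hgy : g y = r := by
    rw [hy, map_sum]
    conv_rhs => rw [← e.sum_repr r, Fin.sum_univ_succ, hr0, zero_smul, zero_add]
    exact Finset.sum_congr rfl fun j _ => by rw [map_smul, hg]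
  let h : Module.End D V := e.constr ℕ
    (Fin.lastCases (δ • e (Fin.last k) + y) (fun j => e j.castSucc))
  have hh : ∀ j : Fin k, h (e j.castSucc) = e j.castSucc := fun j => by
    simp [h]
  have hhlast : h (e (Fin.last k)) = δ • e (Fin.last k) + y := by
    simp [h]
  have hhy : h y = y := by
    rw [hy, map_sum]
    exact Finset.sum_congr rfl fun j _ => by rw [map_smul, hh]
  refine ⟨g, h, isSpannedByEigenvectors_of_companion i e s hs g hg hglast,
    isSpannedByEigenvectors_of_fixes e h hh ?_ hhy hhlast, ?_⟩
  · intro h1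
    apply hsw
    rw [← hp0, ← one_mul (i _), ← h1, hδ, neg_mul, inv_mul_cancel_right₀ hp0']
  · refine e.ext fun j => ?_
    induction j using Fin.lastCases with
    | cast j => rw [LinearMap.comp_apply, hh, hg, hf]
    | last => rw [LinearMap.comp_apply, hhlast, map_add, map_smul, hgy, hr, add_sub_cancel]

end Eigenvectors

/-! ### Splitting off a cyclic summand -/

section CyclicDecomposition

variable {D V : Type*} [DivisionRing D] [AddCommGroup V] [Module D V]

/-- The Hankel matrix `φ (f ^ (i + j) v)` is zero before its antidiagonal and nonzero on it, so
`c_k, c_{k-1}, …` vanish in turn. -/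
theorem eq_zero_of_apply_pow_sum_eq_zero (f : Module.End D V) (φ : V →ₗ[D] D) {k : ℕ} {v : V}
    (hlt : ∀ i < k, φ ((f ^ i) v) = 0) (hk : φ ((f ^ k) v) ≠ 0) (c : Fin (k + 1) → D)
    (hc : ∀ i < k + 1, φ ((f ^ i) (∑ j, c j • (f ^ (j : ℕ)) v)) = 0) : c = 0 := by
  have key : ∀ i < k + 1, ∀ j : Fin (k + 1), (j : ℕ) + i = k → c j = 0 := by
    intro i
    induction i using Nat.strong_induction_on with
    | _ i ih =>
      intro hi j hj
      have h := hc i hi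
      simp only [map_sum, map_smul, ← Module.End.mul_apply, ← pow_add] at h
      rw [Finset.sum_eq_single j] at h
      · rw [add_comm, hj, smul_eq_mul] at h
        exact (mul_eq_zero.1 h).resolve_right hk
      · intro j' _ hne
        rcases lt_or_gt_of_ne (fun hh => hne (Fin.ext hh) : (j' : ℕ) ≠ j) with hlt' | hgt
        · rw [hlt _ (by omega), smul_zero]
        · rw [ih (k - j') (by omega) (by omega) j' (by omega), zero_smul]
      · simp
  funext j
  exact key (k - j) (by omega) j (by omega)

theorem linearIndependent_pow_apply (f : Module.End D V) (φ : V →ₗ[D] D) {k : ℕ} {v : V}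
    (hlt : ∀ i < k, φ ((f ^ i) v) = 0) (hk : φ ((f ^ k) v) ≠ 0) :
    LinearIndependent D (fun j : Fin (k + 1) => (f ^ (j : ℕ)) v) := by
  rw [Fintype.linearIndependent_iff]
  intro c hc
  exact congrFun (eq_zero_of_apply_pow_sum_eq_zero f φ hlt hk c fun i _ => by simp [hc])

/-- Every endomorphism of a nonzero finite-dimensional space has a nonzero cyclic invariant
subspace with an invariant complement. -/
theorem exists_cyclic_isCompl [FiniteDimensional D V] [Nontrivial V] (f : Module.End D V) :
    ∃ (W W' : Submodule D V) (k : ℕ) (e : Module.Basis (Fin (k + 1)) D W),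
      IsCompl W W' ∧ (∀ x ∈ W, f x ∈ W) ∧ (∀ x ∈ W', f x ∈ W') ∧
      ∀ j : Fin k, f (e j.castSucc) = e j.succ := by
  classical
  let P : ℕ → Prop := fun k => ∃ v : V, LinearIndependent D fun j : Fin (k + 1) => (f ^ (j : ℕ)) v
  have hbound : ∀ k, P k → k ≤ Module.finrank D V := by
    rintro k ⟨v, hv⟩
    have := hv.fintype_card_le_finrank
    simp only [Fintype.card_fin] at this
    omega
  have hP0 : P 0 := by
    obtain ⟨v, hv⟩ := exists_ne (0 : V)
    exact ⟨v, (linearIndependent_unique_iff (ι := Fin 1)).2 (by simpa using hv)⟩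
  set k := Nat.findGreatest P (Module.finrank D V) with hk
  obtain ⟨v, hv⟩ : P k := Nat.findGreatest_spec (Nat.zero_le _) hP0
  have hmax : ¬ P (k + 1) := fun h =>
    absurd (Nat.le_findGreatest (hbound _ h) h) (by omega)
  set W := Submodule.span D (Set.range fun j : Fin (k + 1) => (f ^ (j : ℕ)) v) with hW
  let e : Module.Basis (Fin (k + 1)) D W := Module.Basis.span hv
  have he : ∀ j, (e j : V) = (f ^ (j : ℕ)) v := fun j =>
    congrArg Subtype.val (Module.Basis.span_apply hv j)
  have hWinv : ∀ x ∈ W, f x ∈ W := by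
    have hlast : (f ^ (k + 1)) v ∈ W := by
      by_contra hnot
      refine hmax ⟨v, ?_⟩
      have := linearIndependent_finSnoc.2 ⟨hv, hnot⟩
      convert this using 1
      funext j
      induction j using Fin.lastCases <;> simp
    intro x hx
    induction hx using Submodule.span_induction with
    | mem x hx =>
      obtain ⟨j, rfl⟩ := hx
      change f ((f ^ (j : ℕ)) v) ∈ W
      rw [← Module.End.mul_apply, ← pow_succ']
      rcases Nat.lt_or_ge (j + 1 : ℕ) (k + 1) with h | h
      · exact Submodule.subset_span ⟨⟨j + 1, h⟩, rfl⟩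
      · have : (j : ℕ) = k := by omega
        rwa [this]
    | zero => simp
    | add x y _ _ hx hy => rw [map_add]; exact W.add_mem hx hy
    | smul c x _ hx => rw [map_smul]; exact W.smul_mem _ hx
  obtain ⟨φ, hφ⟩ := LinearMap.exists_extend (e.coord (Fin.last k))
  have hφe : ∀ j : Fin (k + 1), φ ((f ^ (j : ℕ)) v) = if j = Fin.last k then 1 else 0 := by
    intro j
    have := LinearMap.congr_fun hφ (e j)
    rw [LinearMap.comp_apply, Submodule.subtype_apply, he] at this
    rw [this, e.coord_apply, e.repr_self, Finsupp.single_apply]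
  have hlt : ∀ i < k, φ ((f ^ i) v) = 0 := fun i hi => by
    have := hφe ⟨i, by omega⟩
    rwa [if_neg (by simp [Fin.ext_iff]; omega)] at this
  have hkne : φ ((f ^ k) v) ≠ 0 := by
    have := hφe (Fin.last k)
    rw [if_pos rfl, Fin.val_last] at this
    rw [this]
    exact one_ne_zero
  -- `Φ` is injective on `W`, and its target has the dimension of `W`, so its kernel is a
  -- complement.
  let Φ : V →ₗ[D] (Fin (k + 1) → D) := LinearMap.pi fun j => φ ∘ₗ (f ^ (j : ℕ))
  have hmem : ∀ x, x ∈ LinearMap.ker Φ ↔ ∀ i < k + 1, φ ((f ^ i) x) = 0 := by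
    intro x
    rw [LinearMap.mem_ker]
    exact ⟨fun h i hi => congrFun h ⟨i, hi⟩, fun h => funext fun j => h j j.2⟩
  have hinj : Function.Injective (Φ ∘ₗ W.subtype) := by
    rw [← LinearMap.ker_eq_bot, LinearMap.ker_eq_bot']
    intro x hx
    have hx' := (hmem (x : V)).1 hx
    have hsum : (x : V) = ∑ j, e.repr x j • (f ^ (j : ℕ)) v := by
      conv_lhs => rw [← e.sum_repr x]
      rw [← W.subtype_apply, map_sum]
      exact Finset.sum_congr rfl fun j _ => by rw [map_smul, W.subtype_apply, he]
    rw [hsum] at hx'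
    have := eq_zero_of_apply_pow_sum_eq_zero f φ hlt hkne _ hx'
    exact e.repr.map_eq_zero_iff.1 (DFunLike.coe_injective this)
  have hsurj : Function.Surjective (Φ ∘ₗ W.subtype) :=
    (LinearMap.injective_iff_surjective_of_finrank_eq_finrank (by
      rw [Module.finrank_eq_card_basis e, Module.finrank_fintype_fun_eq_card])).1 hinj
  refine ⟨W, LinearMap.ker Φ, k, e, ⟨?_, ?_⟩, hWinv, ?_, ?_⟩
  · rw [Submodule.disjoint_def]
    intro x hx hx'
    exact congrArg Subtype.val (hinj (a₁ := ⟨x, hx⟩) (a₂ := 0) (by simpa using hx'))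
  · rw [codisjoint_iff_le_sup]
    intro x _
    obtain ⟨w, hw⟩ := hsurj (Φ x)
    refine Submodule.mem_sup.2 ⟨w, w.2, x - w, ?_, add_sub_cancel _ _⟩
    rw [LinearMap.mem_ker, map_sub, ← hw]
    exact sub_self _
  · intro x hx
    rw [hmem] at hx ⊢
    intro i hi
    rw [← Module.End.mul_apply, ← pow_succ]
    rcases Nat.lt_or_ge (i + 1) (k + 1) with h | h
    · exact hx _ h
    -- Otherwise `x` would have `k + 2` independent iterates, against the maximality of `k`.
    · by_contra hne
      have hik : i = k := by omega
      rw [hik] at hne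
      exact hmax ⟨x, linearIndependent_pow_apply f φ hx hne⟩
  · intro j
    rw [he, he, Fin.val_castSucc, Fin.val_succ, pow_succ', Module.End.mul_apply]

end CyclicDecomposition

/-! ### Gluing the factorizations by induction on dimension -/

section Factorization

variable {D : Type*} [DivisionRing D]

theorem IsSpannedByEigenvectors.of_isCompl {V : Type*} [AddCommGroup V] [Module D V]
    {W W' : Submodule D V} (hc : IsCompl W W') {g₁ : Module.End D W} {g₂ : Module.End D W'}
    (h₁ : g₁.IsSpannedByEigenvectors) (h₂ : g₂.IsSpannedByEigenvectors) (g : Module.End D V)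
    (hg₁ : ∀ x : W, g x = g₁ x) (hg₂ : ∀ x : W', g x = g₂ x) : g.IsSpannedByEigenvectors := by
  rw [IsSpannedByEigenvectors, eq_top_iff, ← hc.sup_eq_top]
  have aux : ∀ (U : Submodule D V) (u : Module.End D U), u.IsSpannedByEigenvectors →
      (∀ x : U, g x = u x) → U ≤ Submodule.span D {x | ∃ a : D, g x = a • x} := by
    intro U u hu hgu
    rw [IsSpannedByEigenvectors] at hu
    rw [← Submodule.map_subtype_top U, ← hu, Submodule.map_span, Submodule.span_le]
    rintro _ ⟨x, ⟨a, ha⟩, rfl⟩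
    exact Submodule.subset_span ⟨a, by simp [hgu, ha]⟩
  exact sup_le (aux W g₁ h₁ hg₁) (aux W' g₂ h₂ hg₂)

/-- Over a division ring containing an infinite commutative field, every endomorphism of a
finite-dimensional space is a product of two endomorphisms spanned by eigenvectors. -/
theorem exists_eq_comp_isSpannedByEigenvectors {K : Type*} [Field K] [Infinite K] (i : K →+* D)
    {V : Type*} [AddCommGroup V] [Module D V] [FiniteDimensional D V] (f : Module.End D V) :
    ∃ g h : Module.End D V,
      g.IsSpannedByEigenvectors ∧ h.IsSpannedByEigenvectors ∧ f = g ∘ₗ h := by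
  induction hn : Module.finrank D V using Nat.strong_induction_on generalizing V with
  | _ n ih =>
    rcases subsingleton_or_nontrivial V with hV | hV
    · exact ⟨0, 0, Subsingleton.elim _ _, Subsingleton.elim _ _, Subsingleton.elim _ _⟩
    obtain ⟨W, W', k, e, hc, hW, hW', he⟩ := f.exists_cyclic_isCompl
    obtain ⟨g₁, h₁, hg₁, hh₁, hf₁⟩ := exists_eq_comp_of_cyclic i e (f.restrict hW)
      fun j => Subtype.ext (he j)
    have hlt : Module.finrank D W' < n := by
      have := Submodule.finrank_add_eq_of_isCompl hc
      rw [Module.finrank_eq_card_basis e, Fintype.card_fin] at this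
      omega
    obtain ⟨g₂, h₂, hg₂, hh₂, hf₂⟩ := ih _ hlt (f.restrict hW') rfl
    let E := Submodule.prodEquivOfIsCompl W W' hc
    let glue : Module.End D W → Module.End D W' → Module.End D V := fun a b =>
      E.toLinearMap ∘ₗ (a.prodMap b) ∘ₗ E.symm.toLinearMap
    have hl : ∀ a b (x : W), glue a b x = a x := fun a b x => by
      simp [glue, E]
    have hr : ∀ a b (x : W'), glue a b x = b x := fun a b x => by
      simp [glue, E]
    refine ⟨glue g₁ g₂, glue h₁ h₂, hg₁.of_isCompl hc hg₂ _ (hl _ _) (hr _ _),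
      hh₁.of_isCompl hc hh₂ _ (hl _ _) (hr _ _), LinearMap.ext fun x => ?_⟩
    obtain ⟨a, ha, b, hb, rfl⟩ := Submodule.mem_sup.1 (hc.sup_eq_top ▸ Submodule.mem_top (x := x))
    have hfa := congrArg Subtype.val (LinearMap.congr_fun hf₁ ⟨a, ha⟩)
    have hfb := congrArg Subtype.val (LinearMap.congr_fun hf₂ ⟨b, hb⟩)
    rw [LinearMap.comp_apply, map_add, map_add, map_add, hl h₁ h₂ ⟨a, ha⟩, hr h₁ h₂ ⟨b, hb⟩, hl, hr]
    exact congrArg₂ (· + ·) hfa hfb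

end Factorization

end Module.End

/-! ### From endomorphisms to matrices -/

theorem Matrix.isDiagonalizable_toMatrixRight' {D : Type*} [DivisionRing D] {n : ℕ}
    {g : Module.End D (Fin n → D)} (hg : g.IsSpannedByEigenvectors) :
    (LinearMap.toMatrixRight' g).IsDiagonalizable := by
  obtain ⟨t, ht, hspan, hli⟩ := exists_linearIndependent D {x | ∃ a : D, g x = a • x}
  have hspan' : ⊤ ≤ Submodule.span D (Set.range ((↑) : t → Fin n → D)) := by
    rw [Subtype.range_coe, hspan]
    exact ge_of_eq hg
  let b₀ := Module.Basis.mk hli hspan'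
  let b := b₀.reindex (b₀.indexEquiv (Pi.basisFun D (Fin n)))
  have hb : ∀ j, ∃ a : D, g (b j) = a • b j := fun j => by
    simp only [b, b₀, Module.Basis.reindex_apply, Module.Basis.mk_apply]
    exact ht (Subtype.coe_prop _)
  choose d hd using hb
  let E := b.equivFun
  refine ⟨⟨LinearMap.toMatrixRight' E.toLinearMap, LinearMap.toMatrixRight' E.symm.toLinearMap,
    ?_, ?_⟩, d, ?_⟩
  · rw [← LinearMap.toMatrixRight'_comp, LinearEquiv.symm_comp, LinearMap.toMatrixRight'_id]
  · rw [← LinearMap.toMatrixRight'_comp, LinearEquiv.comp_symm, LinearMap.toMatrixRight'_id]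
  · change _ = LinearMap.toMatrixRight' E.toLinearMap * Matrix.diagonal d *
      LinearMap.toMatrixRight' E.symm.toLinearMap
    apply Matrix.toLinearMapRight'.injective
    rw [Matrix.toLinearMapRight'_mul, Matrix.toLinearMapRight'_mul]
    simp only [Matrix.toLinearMapRight', LinearEquiv.symm_apply_apply]
    refine b.ext fun j => ?_
    change g (b j) = E.symm (Matrix.vecMul (E (b j)) (Matrix.diagonal d))
    have hE : E (b j) = Pi.single j 1 := by
      ext l
      rw [b.equivFun_self, Pi.single_apply]
      simp only [eq_comm]
    rw [hE, hd, LinearEquiv.eq_symm_apply, map_smul, hE]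
    ext l
    rcases eq_or_ne l j with rfl | h
    · simp [Matrix.vecMul_diagonal]
    · simp [Matrix.vecMul_diagonal, h]

/-- Over a noncommutative division ring every square matrix is already a product of two
diagonalizable matrices. -/
theorem Matrix.exists_eq_mul_isDiagonalizable {D : Type*} [DivisionRing D]
    (hnc : ∃ x y : D, x * y ≠ y * x) {n : ℕ} (A : Matrix (Fin n) (Fin n) D) :
    ∃ B₁ B₂ : Matrix (Fin n) (Fin n) D,
      B₁.IsDiagonalizable ∧ B₂.IsDiagonalizable ∧ A = B₁ * B₂ := by
  obtain ⟨a, ha⟩ := Subfield.exists_infinite_doubleCentralizer hnc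
  obtain ⟨g, h, hg, hh, hA⟩ := Module.End.exists_eq_comp_isSpannedByEigenvectors
    (Subfield.doubleCentralizer a).subtype (Matrix.toLinearMapRight' A)
  -- Matrices act on row vectors from the right, so `g ∘ₗ h` becomes the matrix of `h` times that of
  -- `g`.
  refine ⟨_, _, Matrix.isDiagonalizable_toMatrixRight' hh,
    Matrix.isDiagonalizable_toMatrixRight' hg, ?_⟩
  rw [← LinearMap.toMatrixRight'_comp, ← hA]
  exact (LinearEquiv.apply_symm_apply _ _).symm

theorem mainTheorem6 {D : Type*} [DivisionRing D] [CharP D 2]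
    (hnc : ∃ x y : D, x * y ≠ y * x) (hcard : 4 ≤ ENat.card D)
    (n : ℕ) (hn : 0 < n) (A : Matrix (Fin n) (Fin n) D) :
    ∃ B₁ B₂ B₃ B₄ : Matrix (Fin n) (Fin n) D,
      B₁.IsDiagonalizable ∧ B₂.IsDiagonalizable ∧ B₃.IsDiagonalizable ∧ B₄.IsDiagonalizable ∧
        A = B₁ * B₂ * B₃ * B₄ := by
  obtain ⟨B₁, B₂, h₁, h₂, hA⟩ := A.exists_eq_mul_isDiagonalizable hnc
  have hone : (1 : Matrix (Fin n) (Fin n) D).IsDiagonalizable := ⟨1, 1, by simp⟩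
  exact ⟨B₁, B₂, 1, 1, h₁, h₂, hone, hone, by rw [mul_one, mul_one, hA]⟩
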